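/- Let $\mathcal{H}$ be a separable, infinite dimensional complex Hilbert space. A contractive $C_0$-semigroup on $\mathcal{H}$ is a map $T$ from $\mathbb{R}_{+}=[0,\infty)$ to the bounded linear operators on $\mathcal{H}$ with $T(0)=I$, $T(s+t)=T(s)T(t)$ and $\|T(t)\|\le 1$ for all $s,t\ge 0$, such that $t\mapsto T(t)\xi$ is continuous for every $\xi\in\mathcal{H}$; it is called unitary if every $T(t)$ is a unitary operator. Let $\mathcal{C}$ be the set of all contractive $C_0$-semigroups on $\mathcal{H}$ and $\mathcal{U}\subseteq\mathcal{C}$ the subset of unitary ones. Endow $\mathcal{C}$ with the topology of uniform weak operator convergence on compact subsets of $\mathbb{R}_{+}$ (the $k_{\mathrm{wot}}$-topology), in which a net $(T_i)_i$ converges to $T$ if and only if $$\sup_{t\in K}\bigl|\langle (T_i(t)-T(t))\xi,\eta\rangle\bigr|\longrightarrow 0\quad\text{for all }\xi,\eta\in\mathcal{H}\text{ and all compact }K\subseteq\mathbb{R}_{+}.$$ Then $\mathcal{U}$ is residual in $\mathcal{C}$, i.e. it contains a countable intersection of dense open subsets of $\mathcal{C}$. Moreover, $\mathcal{U}$ is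 of second category in $\mathcal{C}$, i.e. it is not a countable union of nowhere dense subsets of $\mathcal{C}$. -/

import Mathlib

open Topology Filter
open scoped NNReal InnerProductSpace

/-- A contractive `C₀`-semigroup on the complex Hilbert space `H`: a strongly continuous family
`(T t)` of contractions, `t ∈ ℝ₊ = [0, ∞)`, with `T 0 = I` and `T (s + t) = T s T t`. -/
structure ContractiveC0Semigroup (H : Type*) [NormedAddCommGroup H] [InnerProductSpace ℂ H] where
  /-- The underlying operator-valued function on `ℝ₊`. -/
  toFun : ℝ≥0 → H →L[ℂ] H
  map_zero' : toFun 0 = 1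
  map_add' : ∀ s t : ℝ≥0, toFun (s + t) = toFun s * toFun t
  norm_le_one' : ∀ t : ℝ≥0, ‖toFun t‖ ≤ 1
  continuous_sot' : ∀ ξ : H, Continuous fun t : ℝ≥0 => toFun t ξ

namespace ContractiveC0Semigroup

-- so that `⟪ξ, η⟫_ℂ` below elaborates directly to the inner product of `InnerProductSpace ℂ H`
attribute [-instance] WithCStarModule.instCStarModuleComplex

variable {H : Type*} [NormedAddCommGroup H] [InnerProductSpace ℂ H]

instance : CoeFun (ContractiveC0Semigroup H) (fun _ => ℝ≥0 → H →L[ℂ] H) where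
  coe := toFun

/-- The matrix coefficients `t ↦ ⟪T t ξ, η⟫` of a semigroup, indexed by `(ξ, η)`. Each is a
function on `ℝ₊` carrying the structure of uniform convergence on compact subsets of `ℝ₊`. -/
noncomputable def coeffs (T : ContractiveC0Semigroup H) :
    H × H → UniformOnFun ℝ≥0 ℂ {K : Set ℝ≥0 | IsCompact K} :=
  fun p => UniformOnFun.ofFun {K : Set ℝ≥0 | IsCompact K} fun t => ⟪T t p.1, p.2⟫_ℂ

/-- The topology of uniform convergence in the weak operator topology on compact subsets of `ℝ₊`:
`Tᵢ → T` iff `sup_{t ∈ K} |⟪(Tᵢ t - T t) ξ, η⟫| → 0` for all `ξ, η` and all compact `K ⊆ ℝ₊`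
(see `tendsto_kwot_iff`). -/
noncomputable instance kwotTopology : TopologicalSpace (ContractiveC0Semigroup H) :=
  TopologicalSpace.induced coeffs inferInstance

theorem tendsto_kwot_iff {ι : Type*} {l : Filter ι} {S : ι → ContractiveC0Semigroup H}
    {T : ContractiveC0Semigroup H} :
    Tendsto S l (𝓝 T) ↔ ∀ ξ η : H, ∀ K : Set ℝ≥0, IsCompact K → ∀ ε : ℝ, 0 < ε →
      ∀ᶠ i in l, ∀ t ∈ K, ‖⟪(S i t - T t) ξ, η⟫_ℂ‖ < ε := by
  have hi : IsInducing (coeffs (H := H)) := ⟨rfl⟩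
  rw [hi.tendsto_nhds_iff, tendsto_pi_nhds, Prod.forall]
  refine forall_congr' fun ξ => forall_congr' fun η => ?_
  rw [UniformOnFun.tendsto_iff_tendstoUniformlyOn]
  refine forall_congr' fun K => forall_congr' fun _ => ?_
  rw [Metric.tendstoUniformlyOn_iff]
  refine forall_congr' fun ε => forall_congr' fun _ => ?_
  refine eventually_congr (Eventually.of_forall fun i => forall_congr' fun t => ?_)
  refine forall_congr' fun _ => ?_
  rw [dist_comm, dist_eq_norm, sub_apply, inner_sub_left]
  rfl

/-- The unitary `C₀`-semigroups, as a subset of the contractive ones: every `T t` is unitary. -/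
def unitarySemigroups (H : Type*) [NormedAddCommGroup H] [InnerProductSpace ℂ H]
    [CompleteSpace H] : Set (ContractiveC0Semigroup H) :=
  {T | ∀ t : ℝ≥0, T t ∈ unitary (H →L[ℂ] H)}

end ContractiveC0Semigroup

/-! Density rests on dilation. By Sz.-Nagy, `T` is the compression to `H` of a unitary group on a
larger Hilbert space, built here as the reproducing kernel space of `(r, s) ↦ T (s - r)`; positivity
of this kernel is `re_dilationForm_self_nonneg`. The larger space is still separable, so for any
finite set of vectors some unitary from `H` onto it agrees there with the embedding. Transporting
the group back gives a unitary semigroup with the same matrix coefficients on that set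
(`exists_mem_unitarySemigroups_inner_eq`).

Residuality follows because norms are weakly lower semicontinuous: approximate preservation of norms
by `T n` and its adjoint, tested on a dense sequence, gives countably many open conditions. All
unitary semigroups satisfy them, so they are dense, and together they force unitarity.

Second category needs the whole space to be Baire. On isometric semigroups the weak topology is the
strong one, which comes from a complete, countably generated uniformity. Isometric rather than
unitary semigroups are used since strong limits preserve isometry. They are dense, and a space with
a dense Baire subspace is Baire. -/

namespace ContractiveC0Semigroup

/-! ### Positivity of the dilation kernel -/

section

theorem denseRange_linearCombination {ι E : Type*} [NormedAddCommGroup E] [InnerProductSpace ℂ E]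
    {v : ι → E} (hv : (Submodule.span ℂ (Set.range v)).topologicalClosure = ⊤) :
    DenseRange (Finsupp.linearCombination ℂ v) := by
  rw [← Submodule.dense_iff_topologicalClosure_eq_top, ← Finsupp.range_linearCombination] at hv
  exact hv

/-- Two families of vectors with dense spans and the same Gram matrix are unitarily equivalent. -/
theorem exists_linearIsometryEquiv_of_inner_eq {ι E F : Type*} [NormedAddCommGroup E]
    [InnerProductSpace ℂ E] [CompleteSpace E] [NormedAddCommGroup F] [InnerProductSpace ℂ F]
    [CompleteSpace F] {v : ι → E} {w : ι → F}
    (hv : (Submodule.span ℂ (Set.range v)).topologicalClosure = ⊤)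
    (hw : (Submodule.span ℂ (Set.range w)).topologicalClosure = ⊤)
    (h : ∀ i j, ⟪v i, v j⟫_ℂ = ⟪w i, w j⟫_ℂ) :
    ∃ U : E ≃ₗᵢ[ℂ] F, ∀ i, U (v i) = w i := by
  have dv := denseRange_linearCombination hv
  have dw := denseRange_linearCombination hw
  have hnorm (x : ι →₀ ℂ) : ‖Finsupp.linearCombination ℂ w (LinearEquiv.refl ℂ (ι →₀ ℂ) x)‖ =
      ‖Finsupp.linearCombination ℂ v x‖ := by
    rw [LinearEquiv.refl_apply, @norm_eq_sqrt_re_inner ℂ, @norm_eq_sqrt_re_inner ℂ]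
    simp [Finsupp.linearCombination_apply, Finsupp.sum_inner, Finsupp.inner_sum, inner_smul_left,
      inner_smul_right, h, -inner_self_eq_norm_sq_to_K]
  refine ⟨(LinearEquiv.refl ℂ (ι →₀ ℂ)).extendOfIsometry _ _ dv dw hnorm, fun i => ?_⟩
  have := LinearEquiv.extendOfIsometry_eq (LinearEquiv.refl ℂ (ι →₀ ℂ)) _ _ dv dw hnorm
    (Finsupp.single i 1)
  simpa using this

variable {H : Type*} [NormedAddCommGroup H] [InnerProductSpace ℂ H]

theorem norm_apply_le (T : ContractiveC0Semigroup H) (t : ℝ≥0) (ξ : H) : ‖T t ξ‖ ≤ ‖ξ‖ :=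
  ((T t).le_of_opNorm_le (T.norm_le_one' t) ξ).trans_eq (one_mul _)

variable [CompleteSpace H]

/-- The operator-valued kernel `(r, s) ↦ T (s - r)` on `ℝ`, where `T (-t)` stands for `(T t)†`. -/
noncomputable def dilationKernel (T : ContractiveC0Semigroup H) (r s : ℝ) : H →L[ℂ] H :=
  if r ≤ s then T (s - r).toNNReal else (T (r - s).toNNReal).adjoint

theorem dilationKernel_of_le (T : ContractiveC0Semigroup H) {r s : ℝ} (h : r ≤ s) :
    dilationKernel T r s = T (s - r).toNNReal := by
  simp [dilationKernel, h]

theorem dilationKernel_self (T : ContractiveC0Semigroup H) (r : ℝ) :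
    dilationKernel T r r = 1 := by
  simp [dilationKernel, T.map_zero']

theorem dilationKernel_add_add (T : ContractiveC0Semigroup H) (r s t : ℝ) :
    dilationKernel T (r + t) (s + t) = dilationKernel T r s := by
  simp [dilationKernel]

theorem isHermitian_dilationKernel (T : ContractiveC0Semigroup H) :
    (Matrix.of (dilationKernel T)).IsHermitian := by
  ext1 r s
  rw [Matrix.conjTranspose_apply, Matrix.of_apply, Matrix.of_apply,
    ContinuousLinearMap.star_eq_adjoint]
  rcases lt_trichotomy r s with h | rfl | h
  · simp [dilationKernel, h.le, not_le.2 h]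
  · rw [dilationKernel_self]; exact star_one _
  · simp [dilationKernel, h.le, not_le.2 h]

theorem dilationKernel_of_le_of_le (T : ContractiveC0Semigroup H) {r s t : ℝ} (h : r ≤ s)
    (h' : s ≤ t) : dilationKernel T r t = dilationKernel T r s * dilationKernel T s t := by
  rw [dilationKernel_of_le T h, dilationKernel_of_le T h', dilationKernel_of_le T (h.trans h'),
    ← T.map_add', ← Real.toNNReal_add (sub_nonneg.2 h) (sub_nonneg.2 h')]
  congr 2; ring

/-- The sesquilinear form on finitely supported functions `ℝ → H` given by the kernel. -/
noncomputable def dilationForm (T : ContractiveC0Semigroup H) (f g : ℝ →₀ H) : ℂ :=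
  f.sum fun s v => g.sum fun r w => ⟪dilationKernel T r s v, w⟫_ℂ

theorem dilationForm_add_left (T : ContractiveC0Semigroup H) (f f' g : ℝ →₀ H) :
    dilationForm T (f + f') g = dilationForm T f g + dilationForm T f' g := by
  rw [dilationForm, Finsupp.sum_add_index'] <;>
    simp [dilationForm, ← Finsupp.sum_add]

theorem dilationForm_add_right (T : ContractiveC0Semigroup H) (f g g' : ℝ →₀ H) :
    dilationForm T f (g + g') = dilationForm T f g + dilationForm T f g' := by
  simp only [dilationForm, ← Finsupp.sum_add]
  refine Finset.sum_congr rfl fun s _ => ?_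
  beta_reduce
  rw [Finsupp.sum_add_index'] <;> simp

theorem dilationForm_single_left (T : ContractiveC0Semigroup H) (s : ℝ) (v : H) (g : ℝ →₀ H) :
    dilationForm T (.single s v) g = g.sum fun r w => ⟪dilationKernel T r s v, w⟫_ℂ := by
  simp [dilationForm]

theorem conj_dilationForm (T : ContractiveC0Semigroup H) (f g : ℝ →₀ H) :
    (starRingEnd ℂ) (dilationForm T f g) = dilationForm T g f := by
  rw [dilationForm, Finsupp.sum_comm, dilationForm]
  simp only [map_finsuppSum]
  refine Finset.sum_congr rfl fun r _ => Finset.sum_congr rfl fun s _ => ?_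
  have h := (isHermitian_dilationKernel T).apply s r
  simp only [Matrix.of_apply] at h
  beta_reduce
  rw [inner_conj_symm, ← h,
    ContinuousLinearMap.star_eq_adjoint, ContinuousLinearMap.adjoint_inner_left]

theorem re_dilationForm_add_single (T : ContractiveC0Semigroup H) (g : ℝ →₀ H) (s : ℝ) (v : H) :
    (dilationForm T (g + .single s v) (g + .single s v)).re =
      (dilationForm T g g).re + 2 * (dilationForm T (.single s v) g).re + ‖v‖ ^ 2 := by
  have h1 : (dilationForm T g (.single s v)).re = (dilationForm T (.single s v) g).re := by
    rw [← conj_dilationForm, Complex.conj_re]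
  have h2 : (dilationForm T (.single s v) (.single s v)).re = ‖v‖ ^ 2 := by
    rw [dilationForm_single_left, Finsupp.sum_single_index (by simp), dilationKernel_self,
      one_apply_eq_self]
    exact inner_self_eq_norm_sq (𝕜 := ℂ) v
  rw [dilationForm_add_left, dilationForm_add_right, dilationForm_add_right]
  simp only [Complex.add_re, h1, h2]
  ring

/-- Move the mass at the largest support point `a` to the next one `b`, replacing `f a` by `v = T (a
- b) (f a)`. Cross terms are unchanged, because the kernel factors through `b`, and the diagonal
term can only drop, because `T` is contractive. The new function has smaller support, so induction
applies. -/
theorem re_dilationForm_self_nonneg (T : ContractiveC0Semigroup H) (f : ℝ →₀ H) :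
    0 ≤ (dilationForm T f f).re := by
  induction hn : f.support.card using Nat.strong_induction_on generalizing f with
  | _ n ih =>
  subst hn
  rcases f.support.eq_empty_or_nonempty with h0 | hne
  · rw [Finsupp.support_eq_empty.1 h0]; simp [dilationForm]
  set a := f.support.max' hne with ha
  set g := f.erase a with hg
  have ham : a ∈ f.support := Finset.max'_mem _ _
  have hfg : f = g + .single a (f a) := (Finsupp.erase_add_single a f).symm
  have hcard : g.support.card < f.support.card := by
    rw [hg, Finsupp.support_erase]; exact Finset.card_erase_lt_of_mem ham
  rcases g.support.eq_empty_or_nonempty with h0 | hne'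
  · rw [hfg, Finsupp.support_eq_empty.1 h0, re_dilationForm_add_single]
    simp [dilationForm]
  set b := g.support.max' hne' with hb
  have hbm : b ∈ g.support := Finset.max'_mem _ _
  have hba : b ≤ a := Finset.le_max' _ _ (by
    rw [hg, Finsupp.support_erase] at hbm; exact Finset.mem_of_mem_erase hbm)
  set v := dilationKernel T b a (f a) with hv
  have hform : dilationForm T (.single a (f a)) g = dilationForm T (.single b v) g := by
    rw [dilationForm_single_left, dilationForm_single_left]
    refine Finset.sum_congr rfl fun r hr => ?_
    beta_reduce
    rw [dilationKernel_of_le_of_le T (Finset.le_max' _ _ hr) hba]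
    rfl
  have hvn : ‖v‖ ≤ ‖f a‖ := by
    rw [hv, dilationKernel_of_le T hba]
    exact T.norm_apply_le _ _
  have hih := ih _ (lt_of_le_of_lt (Finset.card_le_card (Finsupp.support_add.trans
    (Finset.union_subset subset_rfl (Finsupp.support_single_subset.trans
      (Finset.singleton_subset_iff.2 hbm))))) hcard) (g + .single b v) rfl
  rw [re_dilationForm_add_single, ← hform] at hih
  rw [hfg, re_dilationForm_add_single]
  have := pow_le_pow_left₀ (norm_nonneg _) hvn 2
  linarith

open scoped ComplexOrder in
instance fact_posSemidef_dilationKernel (T : ContractiveC0Semigroup H) :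
    Fact (Matrix.of (dilationKernel T)).PosSemidef :=
  ⟨(List.TFAE.out (RKHS.posSemidef_tfae (K := Matrix.of (dilationKernel T))) 0 2).2
    (And.intro (isHermitian_dilationKernel T) (re_dilationForm_self_nonneg T))⟩

end

/-! ### The unitary dilation -/

section

variable {H : Type*} [NormedAddCommGroup H] [InnerProductSpace ℂ H] [CompleteSpace H]

/-- The Hilbert space of the minimal unitary dilation of `T`. -/
abbrev DilationSpace (T : ContractiveC0Semigroup H) :=
  RKHS.OfKernel (Matrix.of (dilationKernel T))

/-- The vector of the dilation space that is the translate by `s` of the copy of `ξ`. -/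
noncomputable def dilationVector (T : ContractiveC0Semigroup H) (s : ℝ) : H →L[ℂ] DilationSpace T :=
  RKHS.kerFun (DilationSpace T) s

theorem inner_dilationVector (T : ContractiveC0Semigroup H) (s r : ℝ) (ξ η : H) :
    ⟪dilationVector T s ξ, dilationVector T r η⟫_ℂ = ⟪dilationKernel T r s ξ, η⟫_ℂ := by
  rw [dilationVector, dilationVector, ← RKHS.kernel_inner, RKHS.OfKernel.kernel_ofKernel,
    Matrix.of_apply]

/-- The offset `t` only reindexes the family; it lets one lemma cover both source and target of the
shift. -/
theorem closure_span_dilationVector (T : ContractiveC0Semigroup H) (t : ℝ) :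
    (Submodule.span ℂ (Set.range fun p : ℝ × H =>
      dilationVector T (t + p.1) p.2)).topologicalClosure = ⊤ := by
  rw [← RKHS.kerFun_dense (DilationSpace T)]
  congr 2
  ext x
  constructor
  · rintro ⟨p, rfl⟩; exact ⟨_, _, rfl⟩
  · rintro ⟨s, v, rfl⟩; exact ⟨(s - t, v), by simp [dilationVector]⟩

theorem exists_dilationShift (T : ContractiveC0Semigroup H) (t : ℝ) :
    ∃ U : DilationSpace T ≃ₗᵢ[ℂ] DilationSpace T, ∀ p : ℝ × H,
      U (dilationVector T p.1 p.2) = dilationVector T (t + p.1) p.2 := by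
  refine exists_linearIsometryEquiv_of_inner_eq (ι := ℝ × H)
    (v := fun p => dilationVector T p.1 p.2) ?_ (closure_span_dilationVector T t) fun p q => ?_
  · simpa using closure_span_dilationVector T 0
  · rw [inner_dilationVector, inner_dilationVector, add_comm t, add_comm t, dilationKernel_add_add]

/-- The unitary group dilating `T`: translation by `t`. -/
noncomputable def dilationShift (T : ContractiveC0Semigroup H) (t : ℝ) :
    DilationSpace T ≃ₗᵢ[ℂ] DilationSpace T :=
  (exists_dilationShift T t).choose

theorem dilationShift_dilationVector (T : ContractiveC0Semigroup H) (t s : ℝ) (ξ : H) :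
    dilationShift T t (dilationVector T s ξ) = dilationVector T (t + s) ξ :=
  (exists_dilationShift T t).choose_spec (s, ξ)

theorem dilationSpace_induction (T : ContractiveC0Semigroup H) {p : DilationSpace T → Prop}
    (mem : ∀ s ξ, p (dilationVector T s ξ)) (zero : p 0) (add : ∀ x y, p x → p y → p (x + y))
    (smul : ∀ (c : ℂ) x, p x → p (c • x)) (closed : IsClosed {x | p x}) (x : DilationSpace T) :
    p x := by
  let S : Submodule ℂ (DilationSpace T) :=
    { carrier := {x | p x}, add_mem' := fun ha hb => add _ _ ha hb, zero_mem' := zero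
      smul_mem' := fun c _ hx => smul c _ hx }
  have h : (Submodule.span ℂ (Set.range fun p : ℝ × H =>
      dilationVector T (0 + p.1) p.2)).topologicalClosure ≤ S :=
    Submodule.topologicalClosure_minimal _
      (Submodule.span_le.2 (by rintro _ ⟨q, rfl⟩; exact mem _ _)) closed
  rw [closure_span_dilationVector] at h
  exact h Submodule.mem_top

theorem dilationShift_zero (T : ContractiveC0Semigroup H) (x : DilationSpace T) :
    dilationShift T 0 x = x := by
  induction x using dilationSpace_induction T with
  | mem s ξ => rw [dilationShift_dilationVector, zero_add]
  | zero => simp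
  | add x y hx hy => rw [map_add, hx, hy]
  | smul c x hx => rw [map_smul, hx]
  | closed => exact isClosed_eq (dilationShift T 0).continuous continuous_id

theorem dilationShift_add (T : ContractiveC0Semigroup H) (s t : ℝ) (x : DilationSpace T) :
    dilationShift T (s + t) x = dilationShift T s (dilationShift T t x) := by
  induction x using dilationSpace_induction T with
  | mem r ξ => simp only [dilationShift_dilationVector, add_assoc]
  | zero => simp
  | add x y hx hy => simp only [map_add, hx, hy]
  | smul c x hx => simp only [map_smul, hx]
  | closed =>
    exact isClosed_eq (dilationShift T _).continuous
      ((dilationShift T s).continuous.comp (dilationShift T t).continuous)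

theorem norm_dilationVector (T : ContractiveC0Semigroup H) (s : ℝ) (ξ : H) :
    ‖dilationVector T s ξ‖ = ‖ξ‖ := by
  rw [@norm_eq_sqrt_re_inner ℂ, inner_dilationVector, dilationKernel_self,
    @norm_eq_sqrt_re_inner ℂ _ _ _ _ ξ, one_apply_eq_self]

/-- Both vectors have norm `‖ξ‖`, so the squared distance is `-2 Re ⟪T |s - t| ξ - ξ, ξ⟫`; then
Cauchy–Schwarz. -/
theorem dist_sq_dilationVector_le (T : ContractiveC0Semigroup H) (s t : ℝ) (ξ : H) :
    ‖dilationVector T s ξ - dilationVector T t ξ‖ ^ 2 ≤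
      2 * ‖ξ‖ * ‖T (|s - t|).toNNReal ξ - ξ‖ := by
  wlog h : t ≤ s generalizing s t
  · rw [norm_sub_rev, abs_sub_comm]; exact this t s (le_of_not_ge h)
  rw [@norm_sub_sq ℂ, norm_dilationVector, norm_dilationVector, inner_dilationVector,
    dilationKernel_of_le T h, abs_of_nonneg (sub_nonneg.2 h)]
  have h1 : RCLike.re ⟪T (s - t).toNNReal ξ - ξ, ξ⟫_ℂ =
      RCLike.re ⟪T (s - t).toNNReal ξ, ξ⟫_ℂ - ‖ξ‖ ^ 2 := by
    rw [inner_sub_left, map_sub, inner_self_eq_norm_sq]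
  have h2 := (RCLike.abs_re_le_norm ⟪T (s - t).toNNReal ξ - ξ, ξ⟫_ℂ).trans (norm_inner_le_norm _ _)
  have h3 := (abs_le.1 h2).1
  linarith [mul_comm ‖ξ‖ ‖T (s - t).toNNReal ξ - ξ‖]

theorem continuous_dilationVector (T : ContractiveC0Semigroup H) (ξ : H) :
    Continuous fun s => dilationVector T s ξ := by
  refine continuous_iff_continuousAt.2 fun t => tendsto_iff_norm_sub_tendsto_zero.2 ?_
  have h1 : Tendsto (fun s : ℝ => 2 * ‖ξ‖ * ‖T (|s - t|).toNNReal ξ - ξ‖) (𝓝 t) (𝓝 0) := by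
    have hc : Continuous fun s : ℝ => 2 * ‖ξ‖ * ‖T (|s - t|).toNNReal ξ - ξ‖ := by
      have := (T.continuous_sot' ξ).comp
        (continuous_real_toNNReal.comp ((continuous_id.sub (continuous_const (y := t))).abs))
      exact continuous_const.mul (this.sub continuous_const).norm
    simpa [T.map_zero'] using hc.tendsto t
  have h2 := squeeze_zero (fun s => sq_nonneg _) (fun s => dist_sq_dilationVector_le T s t ξ) h1
  have h3 := h2.sqrt
  simpa [Real.sqrt_sq] using h3

theorem continuous_dilationShift (T : ContractiveC0Semigroup H) (x : DilationSpace T) :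
    Continuous fun t => dilationShift T t x := by
  induction x using dilationSpace_induction T with
  | mem s ξ =>
    simp only [dilationShift_dilationVector]
    exact (continuous_dilationVector T ξ).comp (continuous_id.add continuous_const)
  | zero => simpa using continuous_const
  | add x y hx hy => simp only [map_add]; exact Continuous.add hx hy
  | smul c x hx => simp only [map_smul]; exact Continuous.const_smul hx c
  | closed =>
    -- The shifts are isometries, so approximating `x` approximates its orbit uniformly in `t`.
    refine isClosed_of_closure_subset fun x hx => ?_
    refine continuous_of_uniform_approx_of_continuous fun u hu => ?_
    obtain ⟨ε, hε, hu⟩ := Metric.mem_uniformity_dist.1 hu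
    obtain ⟨y, hy, hxy⟩ := Metric.mem_closure_iff.1 hx ε hε
    exact ⟨_, hy, fun t => hu (by rwa [LinearIsometryEquiv.dist_map])⟩

instance separableSpace_dilationSpace [TopologicalSpace.SeparableSpace H]
    (T : ContractiveC0Semigroup H) : TopologicalSpace.SeparableSpace (DilationSpace T) := by
  have hc : Continuous fun p : ℝ × H => dilationVector T (0 + p.1) p.2 := by
    refine continuous_iff_continuousAt.2 fun p => tendsto_iff_norm_sub_tendsto_zero.2 ?_
    have h1 : Tendsto (fun q : ℝ × H => ‖q.2 - p.2‖ +
        ‖dilationVector T q.1 p.2 - dilationVector T p.1 p.2‖) (𝓝 p) (𝓝 0) := by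
      have : Continuous (fun q : ℝ × H => ‖q.2 - p.2‖ +
        ‖dilationVector T q.1 p.2 - dilationVector T p.1 p.2‖) :=
        (continuous_snd.sub continuous_const).norm.add
          (((continuous_dilationVector T p.2).comp continuous_fst).sub continuous_const).norm
      simpa using this.tendsto p
    refine squeeze_zero (fun _ => norm_nonneg _) (fun q => ?_) h1
    beta_reduce
    rw [zero_add, zero_add, ← norm_dilationVector T q.1 (q.2 - p.2), map_sub]
    exact norm_sub_le_norm_sub_add_norm_sub _ _ _
  have hs := (TopologicalSpace.isSeparable_range hc).span (R := ℂ) |>.closure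
  rw [← Submodule.topologicalClosure_coe, closure_span_dilationVector, Submodule.top_coe] at hs
  exact TopologicalSpace.isSeparable_univ_iff.1 hs

/-- The `C₀`-semigroup on `H` obtained from a one-parameter unitary group on `K` by transport along a
unitary `H ≃ₗᵢ[ℂ] K`. -/
noncomputable def ofLinearIsometryEquiv {K : Type*} [NormedAddCommGroup K] [InnerProductSpace ℂ K]
    (V : ℝ → K ≃ₗᵢ[ℂ] K) (hzero : ∀ x, V 0 x = x) (hadd : ∀ s t x, V (s + t) x = V s (V t x))
    (hcont : ∀ x, Continuous fun t => V t x) (W : H ≃ₗᵢ[ℂ] K) : ContractiveC0Semigroup H where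
  toFun t := ((W.trans (V t)).trans W.symm).toContinuousLinearEquiv
  map_zero' := by ext x; simp [hzero]
  map_add' s t := by ext x; simp [hadd]
  norm_le_one' t := ContinuousLinearMap.opNorm_le_bound _ zero_le_one fun x => by simp
  continuous_sot' ξ := W.symm.continuous.comp ((hcont (W ξ)).comp NNReal.continuous_coe)

theorem ofLinearIsometryEquiv_mem_unitarySemigroups {K : Type*} [NormedAddCommGroup K]
    [InnerProductSpace ℂ K]
    (V : ℝ → K ≃ₗᵢ[ℂ] K) (hzero : ∀ x, V 0 x = x) (hadd : ∀ s t x, V (s + t) x = V s (V t x))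
    (hcont : ∀ x, Continuous fun t => V t x) (W : H ≃ₗᵢ[ℂ] K) :
    ofLinearIsometryEquiv V hzero hadd hcont W ∈ unitarySemigroups H := fun t =>
  (Unitary.linearIsometryEquiv.symm ((W.trans (V t)).trans W.symm)).2

end

/-! ### Density of the unitary semigroups -/

section

/-- Orthonormal vectors lie at distance `√2 > 1`, so balls of radius `1 / 2` around them are
disjoint. -/
theorem countable_of_orthonormal {E : Type*} [NormedAddCommGroup E] [InnerProductSpace ℂ E]
    [TopologicalSpace.SeparableSpace E] {s : Set E} (hs : Orthonormal ℂ ((↑) : s → E)) :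
    s.Countable := by
  refine Set.PairwiseDisjoint.countable_of_isOpen (s := fun x => Metric.ball x (1 / 2 : ℝ)) ?_
    (fun _ _ => Metric.isOpen_ball) fun x _ => ⟨x, Metric.mem_ball_self (by norm_num)⟩
  intro x hx y hy hxy
  refine Metric.ball_disjoint_ball ?_
  have h0 : ⟪x, y⟫_ℂ = 0 :=
    hs.inner_eq_zero (i := ⟨x, hx⟩) (j := ⟨y, hy⟩) fun h => hxy (congrArg Subtype.val h)
  have hx1 : ‖x‖ = 1 := hs.norm_eq_one ⟨x, hx⟩
  have hy1 : ‖y‖ = 1 := hs.norm_eq_one ⟨y, hy⟩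
  have h := @norm_sub_sq ℂ _ _ _ _ x y
  rw [h0, hx1, hy1] at h
  rw [dist_eq_norm]
  simp at h
  nlinarith [norm_nonneg (x - y)]

theorem _root_.HilbertBasis.infinite {ι E : Type*} [NormedAddCommGroup E] [InnerProductSpace ℂ E]
    (b : HilbertBasis ι ℂ E) (hE : ¬ FiniteDimensional ℂ E) : Infinite ι := by
  by_contra h
  rw [not_infinite_iff_finite] at h
  have := Fintype.ofFinite ι
  exact hE (b.toOrthonormalBasis.toBasis.finiteDimensional_of_finite)

theorem exists_equiv_extending {α β : Type*} {s w : Set α} {s' w' : Set β} (hs : s.Finite)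
    (hsw : s ⊆ w) (hsw' : s' ⊆ w') (e : s ≃ s') (hw : w.Countable) (hw' : w'.Countable)
    (hwi : w.Infinite) (hwi' : w'.Infinite) :
    ∃ f : w ≃ w', ∀ x : s, (f ⟨x, hsw x.2⟩ : β) = e x := by
  classical
  have hs' : s'.Finite := by
    have := hs.to_subtype
    have := Finite.of_equiv s e
    exact s'.toFinite
  have := (hwi.sdiff hs).to_subtype
  have := (hwi'.sdiff hs').to_subtype
  have := (hw.mono (Set.sdiff_subset (t := s))).to_subtype
  have := (hw'.mono (Set.sdiff_subset (t := s'))).to_subtype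
  obtain ⟨g⟩ := nonempty_equiv_of_countable (α := (w \ s : Set α)) (β := (w' \ s' : Set β))
  refine ⟨(Equiv.Set.sumDiffSubset hsw).symm.trans
    ((e.sumCongr g).trans (Equiv.Set.sumDiffSubset hsw')), fun x => ?_⟩
  rw [Equiv.trans_apply, Equiv.trans_apply,
    Equiv.Set.sumDiffSubset_symm_apply_of_mem hsw (x := ⟨x, hsw x.2⟩) x.2]
  simp

/-- An isometry between separable infinite-dimensional Hilbert spaces agrees on every finite set
with a unitary. -/
theorem exists_linearIsometryEquiv_eqOn_finset {H K : Type*} [NormedAddCommGroup H]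
    [InnerProductSpace ℂ H] [CompleteSpace H] [TopologicalSpace.SeparableSpace H]
    [NormedAddCommGroup K] [InnerProductSpace ℂ K] [CompleteSpace K]
    [TopologicalSpace.SeparableSpace K] (hH : ¬ FiniteDimensional ℂ H) (J : H →ₗᵢ[ℂ] K)
    (F : Finset H) : ∃ W : H ≃ₗᵢ[ℂ] K, ∀ ξ ∈ F, W ξ = J ξ := by
  have hK : ¬ FiniteDimensional ℂ K := fun _ =>
    hH (FiniteDimensional.of_injective J.toLinearMap J.injective)
  set S : Submodule ℂ H := Submodule.span ℂ (F : Set H) with hS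
  have : FiniteDimensional ℂ S := FiniteDimensional.span_finset ℂ F
  set b := stdOrthonormalBasis ℂ S
  set v : _ → H := fun i => (b i : H) with hv
  have hvo : Orthonormal ℂ v := b.orthonormal.comp_linearIsometry S.subtypeₗᵢ
  have hJo : Orthonormal ℂ (J ∘ v) := hvo.comp_linearIsometry J
  -- Extend an orthonormal basis of the span of `F`, and its image under `J`, to Hilbert bases. Both
  -- are countably infinite, so the pairing `v i ↦ J (v i)` extends to a bijection.
  obtain ⟨w, c, hsw, hc⟩ := hvo.toSubtypeRange.exists_hilbertBasis_extension
  obtain ⟨w', c', hsw', hc'⟩ := hJo.toSubtypeRange.exists_hilbertBasis_extension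
  have hwo : Orthonormal ℂ ((↑) : w → H) := hc ▸ c.orthonormal
  have hwo' : Orthonormal ℂ ((↑) : w' → K) := hc' ▸ c'.orthonormal
  obtain ⟨f, hf⟩ := exists_equiv_extending (Set.finite_range v) hsw hsw'
    ((Equiv.ofInjective v hvo.linearIndependent.injective).symm.trans
      (Equiv.ofInjective (J ∘ v) hJo.linearIndependent.injective))
    (countable_of_orthonormal hwo) (countable_of_orthonormal hwo')
    (Set.infinite_coe_iff.1 (c.infinite hH)) (Set.infinite_coe_iff.1 (c'.infinite hK))
  obtain ⟨W, hW⟩ := exists_linearIsometryEquiv_of_inner_eq (v := c) (w := c' ∘ f) c.dense_span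
    (by rw [f.surjective.range_comp]; exact c'.dense_span) fun i j => by
      classical
      rw [orthonormal_iff_ite.1 c.orthonormal,
        orthonormal_iff_ite.1 (c'.orthonormal.comp f f.injective)]
  have hWv (i) : W (v i) = J (v i) := by
    have h1 := hW ⟨v i, hsw ⟨i, rfl⟩⟩
    have h2 := hf ⟨v i, i, rfl⟩
    rw [hc] at h1
    rw [h1, Function.comp_apply, hc', h2, Equiv.trans_apply]
    have h3 : (Equiv.ofInjective v hvo.linearIndependent.injective).symm ⟨v i, i, rfl⟩ = i :=
      Equiv.ofInjective_symm_apply hvo.linearIndependent.injective i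
    rw [h3]
    rfl
  refine ⟨W, fun ξ hξ => ?_⟩
  have h := b.sum_repr ⟨ξ, Submodule.subset_span hξ⟩
  have h' := congrArg (S.subtype) h
  simp only [map_sum, map_smul, Submodule.subtype_apply] at h'
  rw [← h']
  simp only [map_sum, map_smul]
  exact Finset.sum_congr rfl fun i _ => by rw [hWv i]

variable {H : Type*} [NormedAddCommGroup H] [InnerProductSpace ℂ H] [CompleteSpace H]
  [TopologicalSpace.SeparableSpace H]

/-- The isometric embedding of `H` into the dilation space. -/
noncomputable def dilationEmbedding (T : ContractiveC0Semigroup H) : H →ₗᵢ[ℂ] DilationSpace T where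
  toLinearMap := (dilationVector T 0).toLinearMap
  norm_map' := norm_dilationVector T 0

/-- On finitely many vectors, a contractive semigroup has the same matrix coefficients as some
unitary semigroup on the same space. -/
theorem exists_mem_unitarySemigroups_inner_eq (hH : ¬ FiniteDimensional ℂ H)
    (T : ContractiveC0Semigroup H) (F : Finset H) :
    ∃ S ∈ unitarySemigroups H, ∀ ξ ∈ F, ∀ η ∈ F, ∀ t, ⟪S t ξ, η⟫_ℂ = ⟪T t ξ, η⟫_ℂ := by
  obtain ⟨W, hW⟩ := exists_linearIsometryEquiv_eqOn_finset hH (dilationEmbedding T) F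
  refine ⟨_, ofLinearIsometryEquiv_mem_unitarySemigroups (dilationShift T) (dilationShift_zero T)
    (dilationShift_add T) (continuous_dilationShift T) W, fun ξ hξ η hη t => ?_⟩
  calc _ = ⟪W.symm (dilationShift T t (W ξ)), η⟫_ℂ := rfl
    _ = ⟪dilationShift T t (W ξ), W η⟫_ℂ := by
      rw [← W.inner_map_map, LinearIsometryEquiv.apply_symm_apply]
    _ = ⟪dilationShift T t (dilationVector T 0 ξ), dilationVector T 0 η⟫_ℂ := by
      rw [hW ξ hξ, hW η hη]; rfl
    _ = _ := by
      rw [dilationShift_dilationVector, inner_dilationVector, add_zero,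
        dilationKernel_of_le T t.coe_nonneg, sub_zero, Real.toNNReal_coe]

theorem dense_unitarySemigroups (hH : ¬ FiniteDimensional ℂ H) : Dense (unitarySemigroups H) := by
  classical
  intro T
  choose S hS hST using exists_mem_unitarySemigroups_inner_eq hH T
  -- The net is indexed by finite sets of vectors under inclusion; each coefficient is eventually
  -- equal to that of `T`.
  refine mem_closure_of_tendsto (f := S) (b := atTop) ?_ (Eventually.of_forall hS)
  refine tendsto_kwot_iff.2 fun ξ η K _ ε hε => ?_
  filter_upwards [eventually_ge_atTop {ξ, η}] with F hF t _
  have h := hST F ξ (hF (by simp)) η (hF (by simp)) t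
  rwa [sub_apply, inner_sub_left, h, sub_self, norm_zero]

end

/-! ### Unitarity as countably many open conditions -/

section
variable {H : Type*} [NormedAddCommGroup H] [InnerProductSpace ℂ H]

theorem continuous_inner_apply (t : ℝ≥0) (ξ η : H) :
    Continuous fun T : ContractiveC0Semigroup H => ⟪T t ξ, η⟫_ℂ := by
  refine continuous_iff_continuousAt.2 fun T => Metric.tendsto_nhds.2 fun ε hε => ?_
  filter_upwards [tendsto_kwot_iff.1 tendsto_id ξ η {t} isCompact_singleton ε hε] with S hS
  simpa [dist_eq_norm, inner_sub_left] using hS t rfl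

/-- The right-hand expression is `‖x‖ ^ 2 - ‖x - y‖ ^ 2`, largest at `y = x`. For fixed `y` it is
weakly continuous in `x`, which makes the norm conditions below open. -/
theorem lt_norm_sq_iff_exists {E : Type*} [NormedAddCommGroup E] [InnerProductSpace ℂ E] (c : ℝ)
    (x : E) : c < ‖x‖ ^ 2 ↔ ∃ y, c < 2 * (⟪x, y⟫_ℂ).re - ‖y‖ ^ 2 := by
  constructor
  · intro h
    have := inner_self_eq_norm_sq (𝕜 := ℂ) x
    rw [RCLike.re_eq_complex_re] at this
    exact ⟨x, by rw [this]; linarith⟩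
  · rintro ⟨y, hy⟩
    have := @norm_sub_sq ℂ _ _ _ _ x y
    rw [RCLike.re_eq_complex_re] at this
    nlinarith [sq_nonneg ‖x - y‖]

theorem isOpen_setOf_lt_norm_apply_sq (c : ℝ) (t : ℝ≥0) (ξ : H) :
    IsOpen {T : ContractiveC0Semigroup H | c < ‖T t ξ‖ ^ 2} := by
  simp only [lt_norm_sq_iff_exists, Set.ofPred_exists]
  exact isOpen_iUnion fun η => isOpen_lt continuous_const
    ((continuous_const.mul (Complex.continuous_re.comp (continuous_inner_apply t ξ η))).sub
      continuous_const)

variable [CompleteSpace H]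

theorem isOpen_setOf_lt_norm_adjoint_apply_sq (c : ℝ) (t : ℝ≥0) (ξ : H) :
    IsOpen {T : ContractiveC0Semigroup H | c < ‖(T t).adjoint ξ‖ ^ 2} := by
  simp only [lt_norm_sq_iff_exists, Set.ofPred_exists, ContinuousLinearMap.adjoint_inner_left]
  refine isOpen_iUnion fun η => isOpen_lt continuous_const
    ((continuous_const.mul (Complex.continuous_re.comp ?_)).sub continuous_const)
  simp_rw [← inner_conj_symm ξ]
  exact Complex.continuous_conj.comp (continuous_inner_apply t η ξ)

theorem norm_adjoint_apply_le (T : ContractiveC0Semigroup H) (t : ℝ≥0) (ξ : H) :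
    ‖(T t).adjoint ξ‖ ≤ ‖ξ‖ :=
  ((T t).adjoint.le_of_opNorm_le
    ((LinearIsometryEquiv.norm_map _ _).trans_le (T.norm_le_one' t)) ξ).trans_eq (one_mul _)

theorem mem_unitary_iff_norm_eq (A : H →L[ℂ] H) :
    A ∈ unitary (H →L[ℂ] H) ↔ (∀ ξ, ‖A ξ‖ = ‖ξ‖) ∧ ∀ ξ, ‖A.adjoint ξ‖ = ‖ξ‖ := by
  rw [Unitary.mem_iff, ContinuousLinearMap.norm_map_iff_adjoint_comp_self,
    ContinuousLinearMap.norm_map_iff_adjoint_comp_self, ContinuousLinearMap.adjoint_adjoint]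
  rfl

/-- A semigroup all of whose operators `T n` almost preserve norms of the vectors in a dense
sequence, along with their adjoints, is unitary. -/
theorem mem_unitarySemigroups_of_denseRange {d : ℕ → H} (hd : DenseRange d)
    {T : ContractiveC0Semigroup H}
    (h : ∀ n k m : ℕ, ‖d k‖ ^ 2 - 1 / (m + 1) < ‖T n (d k)‖ ^ 2 ∧
      ‖d k‖ ^ 2 - 1 / (m + 1) < ‖(T n).adjoint (d k)‖ ^ 2) : T ∈ unitarySemigroups H := by
  have key (A : H →L[ℂ] H)
      (hA : ∀ k m : ℕ, ‖d k‖ ^ 2 - 1 / (m + 1) < ‖A (d k)‖ ^ 2) (ξ : H) : ‖ξ‖ ≤ ‖A ξ‖ := by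
    induction ξ using hd.induction_on with
    | hp => exact isClosed_le continuous_norm A.continuous.norm
    | ih k =>
      refine (sq_le_sq₀ (norm_nonneg _) (norm_nonneg _)).1 (le_of_forall_pos_lt_add fun ε hε => ?_)
      obtain ⟨m, hm⟩ := exists_nat_one_div_lt hε
      linarith [hA k m]
  intro t
  obtain ⟨n, hn⟩ := exists_nat_ge t
  rw [mem_unitary_iff_norm_eq]
  refine ⟨fun ξ => (T.norm_apply_le t ξ).antisymm ?_,
    fun ξ => (T.norm_adjoint_apply_le t ξ).antisymm ?_⟩
  -- Integer times suffice: `T n = T (n - t) T t` with `T (n - t)` contractive. The adjoint reverses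
  -- products, hence the opposite splitting in the second case.
  · refine (key (T n) (fun k m => (h n k m).1) ξ).trans ?_
    rw [← tsub_add_cancel_of_le hn, T.map_add']
    exact T.norm_apply_le _ _
  · refine (key (T n).adjoint (fun k m => (h n k m).2) ξ).trans ?_
    rw [← add_tsub_cancel_of_le hn, T.map_add', ContinuousLinearMap.mul_def,
      ContinuousLinearMap.adjoint_comp, ContinuousLinearMap.comp_apply]
    exact T.norm_adjoint_apply_le _ _

theorem unitarySemigroups_mem_residual [TopologicalSpace.SeparableSpace H]
    (hU : Dense (unitarySemigroups H)) :
    unitarySemigroups H ∈ residual (ContractiveC0Semigroup H) := by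
  have hpos (m : ℕ) : (0 : ℝ) < 1 / (m + 1) := Nat.one_div_pos_of_nat
  let d := TopologicalSpace.denseSeq H
  have h : ∀ᶠ T in residual (ContractiveC0Semigroup H), ∀ n k m : ℕ,
      ‖d k‖ ^ 2 - 1 / (m + 1) < ‖T n (d k)‖ ^ 2 ∧
      ‖d k‖ ^ 2 - 1 / (m + 1) < ‖(T n).adjoint (d k)‖ ^ 2 := by
    simp only [eventually_countable_forall, eventually_and]
    refine fun n k m => ⟨residual_of_dense_open (isOpen_setOf_lt_norm_apply_sq _ _ _)
      (hU.mono fun T hT => ?_), residual_of_dense_open (isOpen_setOf_lt_norm_adjoint_apply_sq _ _ _)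
      (hU.mono fun T hT => ?_)⟩
    · change ‖d k‖ ^ 2 - 1 / (m + 1) < ‖T n (d k)‖ ^ 2
      rw [((mem_unitary_iff_norm_eq _).1 (hT n)).1]
      linarith [hpos m]
    · change ‖d k‖ ^ 2 - 1 / (m + 1) < ‖(T n).adjoint (d k)‖ ^ 2
      rw [((mem_unitary_iff_norm_eq _).1 (hT n)).2]
      linarith [hpos m]
  filter_upwards [h] with T hT
  exact mem_unitarySemigroups_of_denseRange (TopologicalSpace.denseRange_denseSeq H) hT

end

/-! ### The Baire property -/

section
open scoped Uniformity
variable {H : Type*} [NormedAddCommGroup H] [InnerProductSpace ℂ H]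

/-- The semigroups consisting of isometries. -/
def isometricSemigroups (H : Type*) [NormedAddCommGroup H] [InnerProductSpace ℂ H] :
    Set (ContractiveC0Semigroup H) :=
  {T | ∀ t ξ, ‖T t ξ‖ = ‖ξ‖}

/-- Among isometric semigroups, weak convergence uniformly on compacts is strong. -/
theorem eventually_norm_sub_lt_of_tendsto_kwot {ι : Type*} {l : Filter ι}
    {S : ι → ContractiveC0Semigroup H} {T : ContractiveC0Semigroup H}
    (hS : ∀ i, S i ∈ isometricSemigroups H) (hT : T ∈ isometricSemigroups H)
    (h : Tendsto S l (𝓝 T)) (ξ : H) {K : Set ℝ≥0} (hK : IsCompact K) {ε : ℝ} (hε : 0 < ε) :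
    ∀ᶠ i in l, ∀ t ∈ K, ‖S i t ξ - T t ξ‖ < ε := by
  -- Chosen so that `2 * (1 + 2 * ‖ξ‖) * δ = ε ^ 2`, the final bound on the squared norm.
  set δ : ℝ := ε ^ 2 / (2 * (1 + 2 * ‖ξ‖)) with hδ
  have hδ0 : 0 < δ := by positivity
  -- The moving test vector `T t ξ` stays in a compact set, so finitely many fixed ones suffice.
  obtain ⟨F, -, hF, hFc⟩ := (hK.image (T.continuous_sot' ξ)).finite_cover_balls hδ0
  have h1 : ∀ᶠ i in l, ∀ y ∈ F, ∀ t ∈ K, ‖⟪(S i t - T t) ξ, y⟫_ℂ‖ < δ :=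
    (eventually_all_finite hF).2 fun y _ => tendsto_kwot_iff.1 h ξ y K hK δ hδ0
  filter_upwards [h1] with i hi t ht
  obtain ⟨y, hy, hty⟩ := Set.mem_iUnion₂.1 (hFc ⟨t, ht, rfl⟩)
  rw [Metric.mem_ball, dist_eq_norm] at hty
  have h2 : ‖S i t ξ - T t ξ‖ ≤ 2 * ‖ξ‖ := by
    refine (norm_sub_le _ _).trans ?_
    rw [hS i, hT]; linarith
  have h3 : ‖⟪S i t ξ - T t ξ, T t ξ - y⟫_ℂ‖ ≤ 2 * ‖ξ‖ * δ :=
    (norm_inner_le_norm _ _).trans (mul_le_mul h2 hty.le (norm_nonneg _) (by positivity))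
  have h4 := hi y hy t ht
  rw [sub_apply] at h4
  have h5 : ‖⟪S i t ξ - T t ξ, T t ξ⟫_ℂ‖ < (1 + 2 * ‖ξ‖) * δ := by
    calc _ = ‖⟪S i t ξ - T t ξ, y⟫_ℂ + ⟪S i t ξ - T t ξ, T t ξ - y⟫_ℂ‖ := by
          rw [← inner_add_right, add_sub_cancel]
      _ ≤ _ := norm_add_le _ _
      _ < _ := by linarith
  have h6 : ‖S i t ξ - T t ξ‖ ^ 2 = -2 * RCLike.re ⟪S i t ξ - T t ξ, T t ξ⟫_ℂ := by
    rw [@norm_sub_sq ℂ, inner_sub_left, map_sub, inner_self_eq_norm_sq, hS i, hT]; ring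
  have h7 := (abs_le.1 (RCLike.abs_re_le_norm ⟪S i t ξ - T t ξ, T t ξ⟫_ℂ)).1
  have h8 : 2 * ((1 + 2 * ‖ξ‖) * δ) = ε ^ 2 := by
    rw [hδ]; field_simp
  exact lt_of_pow_lt_pow_left₀ 2 hε.le (by linarith)

instance : Nonempty (ContractiveC0Semigroup H) :=
  ⟨⟨fun _ => 1, rfl, fun _ _ => (one_mul 1).symm, fun _ => ContinuousLinearMap.norm_id_le,
    fun _ => continuous_const⟩⟩

/-- The orbit map `t ↦ T t ξ`. -/
def orbit (T : ContractiveC0Semigroup H) (ξ : H) : C(ℝ≥0, H) := ⟨fun t => T t ξ, T.continuous_sot' ξ⟩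

theorem continuous_of_continuous_orbit {X : Type*} [TopologicalSpace X]
    {S : X → ContractiveC0Semigroup H} (hS : ∀ ξ, Continuous fun x => orbit (S x) ξ) :
    Continuous S := by
  refine continuous_iff_continuousAt.2 fun x => tendsto_kwot_iff.2 fun ξ η K hK ε hε => ?_
  have h := Metric.tendstoUniformlyOn_iff.1
    (ContinuousMap.tendsto_iff_forall_isCompact_tendstoUniformlyOn.1 ((hS ξ).tendsto x) K hK)
    (ε / (‖η‖ + 1)) (by positivity)
  filter_upwards [h] with y hy t ht
  have h1 : ‖S y t ξ - S x t ξ‖ < ε / (‖η‖ + 1) := by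
    rw [← dist_eq_norm, dist_comm]; exact hy t ht
  rw [lt_div_iff₀ (by positivity)] at h1
  refine (norm_inner_le_norm _ _).trans_lt ?_
  rw [sub_apply]
  nlinarith [norm_nonneg (S y t ξ - S x t ξ)]

/-- The uniform structure on isometric semigroups of uniform convergence on compacts of the orbits
of a sequence of vectors. -/
abbrev orbitUniformSpace (d : ℕ → H) : UniformSpace (isometricSemigroups H) :=
  UniformSpace.comap (fun T n => orbit T.1 (d n)) inferInstance

/-- For isometric `T` the orbits of `ξ` and `d n` differ by exactly `‖ξ - d n‖`, uniformly in `t`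
and `T`. -/
theorem uniformContinuous_orbit {d : ℕ → H} (hd : DenseRange d) (ξ : H) :
    @UniformContinuous _ _ (orbitUniformSpace d) _
      fun T : isometricSemigroups H => orbit T.1 ξ := by
  let _ := orbitUniformSpace d
  refine uniformContinuous_of_uniform_approx_of_uniformContinuous fun u hu => ?_
  obtain ⟨K, V, -, hV, hu⟩ := ContinuousMap.mem_compactConvergence_entourage_iff _ |>.1 hu
  obtain ⟨ε, hε, hV⟩ := Metric.mem_uniformity_dist.1 hV
  obtain ⟨n, hn⟩ := hd.exists_dist_lt ξ hε
  refine ⟨fun T => orbit T.1 (d n), ?_, fun T => hu fun t _ => hV ?_⟩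
  · exact (Pi.uniformContinuous_proj (fun _ : ℕ => C(ℝ≥0, H)) n).comp uniformContinuous_comap
  · change dist (T.1 t ξ) (T.1 t (d n)) < ε
    rwa [dist_eq_norm, ← map_sub, T.2, ← dist_eq_norm]

theorem orbitUniformSpace_toTopologicalSpace {d : ℕ → H} (hd : DenseRange d) :
    (orbitUniformSpace d).toTopologicalSpace = instTopologicalSpaceSubtype := by
  refine le_antisymm ?_ ?_
  · exact continuous_iff_le_induced.1 (@continuous_of_continuous_orbit _ _ _ _
      (orbitUniformSpace d).toTopologicalSpace _ fun ξ =>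
        @UniformContinuous.continuous _ _ (orbitUniformSpace d) _ _ (uniformContinuous_orbit hd ξ))
  · refine continuous_iff_le_induced.1 (continuous_pi fun n => ?_)
    refine continuous_iff_continuousAt.2 fun T => ?_
    refine ContinuousMap.tendsto_iff_forall_isCompact_tendstoUniformlyOn.2 fun K hK => ?_
    refine Metric.tendstoUniformlyOn_iff.2 fun ε hε => ?_
    filter_upwards [eventually_norm_sub_lt_of_tendsto_kwot (fun S : isometricSemigroups H => S.2)
      T.2 continuous_subtype_val.continuousAt (d n) hK hε] with S hS t ht
    rw [dist_comm, dist_eq_norm]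
    exact hS t ht

/-- A family of orbits that is a pointwise limit of orbits of isometric semigroups is the family of
orbits of an isometric semigroup. -/
theorem exists_orbit_eq_of_tendsto {ι : Type*} {l : Filter ι} [l.NeBot]
    {S : ι → ContractiveC0Semigroup H} (hS : ∀ i, S i ∈ isometricSemigroups H)
    {f : H → C(ℝ≥0, H)} (hf : ∀ ξ t, Tendsto (fun i => S i t ξ) l (𝓝 (f ξ t))) :
    ∃ T ∈ isometricSemigroups H, ∀ ξ, orbit T ξ = f ξ := by
  have hadd (ξ η : H) (t : ℝ≥0) : f (ξ + η) t = f ξ t + f η t :=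
    tendsto_nhds_unique (hf (ξ + η) t) (by simpa only [map_add] using (hf ξ t).add (hf η t))
  have hsmul (c : ℂ) (ξ : H) (t : ℝ≥0) : f (c • ξ) t = c • f ξ t :=
    tendsto_nhds_unique (hf (c • ξ) t) (by simpa only [map_smul] using (hf ξ t).const_smul c)
  have hnorm (ξ : H) (t : ℝ≥0) : ‖f ξ t‖ = ‖ξ‖ :=
    tendsto_nhds_unique (hf ξ t).norm (by simpa only [hS _ t ξ] using tendsto_const_nhds)
  have hmul (s t : ℝ≥0) (ξ : H) : f ξ (s + t) = f (f ξ t) s := by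
    refine tendsto_nhds_unique (hf ξ (s + t)) ?_
    -- Isometry of `S i s` allows the limit to pass through the product.
    have h1 : Tendsto (fun i => S i s (S i t ξ - f ξ t)) l (𝓝 0) := by
      refine tendsto_zero_iff_norm_tendsto_zero.2 ?_
      simp only [hS _ s _]
      exact tendsto_iff_norm_sub_tendsto_zero.1 (hf ξ t)
    simpa [map_sub, (S _).map_add'] using h1.add (hf (f ξ t) s)
  let A (t : ℝ≥0) : H →L[ℂ] H := LinearMap.mkContinuous
    { toFun := fun ξ => f ξ t, map_add' := fun ξ η => hadd ξ η t, map_smul' := fun c ξ => hsmul c ξ t }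
    1 fun ξ => by simp [hnorm]
  refine ⟨⟨A, ?_, ?_, fun t => LinearMap.mkContinuous_norm_le _ zero_le_one _,
    fun ξ => (f ξ).continuous⟩, fun t ξ => hnorm ξ t, fun ξ => rfl⟩
  · ext ξ
    exact tendsto_nhds_unique (hf ξ 0) (by simp [(S _).map_zero'])
  · intro s t
    ext ξ
    exact hmul s t ξ

variable [CompleteSpace H]

theorem unitarySemigroups_subset_isometricSemigroups :
    unitarySemigroups H ⊆ isometricSemigroups H := fun _ hT t =>
  ((mem_unitary_iff_norm_eq _).1 (hT t)).1

/-- A Cauchy filter makes every orbit, not only those of the `d n`, converge in the complete space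
`C(ℝ≥0, H)`, and the limits are again orbits. -/
theorem completeSpace_orbitUniformSpace {d : ℕ → H} (hd : DenseRange d) :
    @CompleteSpace _ (orbitUniformSpace d) := by
  let _ := orbitUniformSpace d
  refine ⟨fun {l} hl => ?_⟩
  have := hl.1
  choose f hf using fun ξ => cauchy_iff_exists_le_nhds.1 (hl.map (uniformContinuous_orbit hd ξ))
  obtain ⟨T, hT, hTf⟩ := exists_orbit_eq_of_tendsto (l := l) (fun S : isometricSemigroups H => S.2)
    (f := f) fun ξ t => ((continuous_eval_const t).tendsto (f ξ)).comp (hf ξ)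
  refine ⟨⟨T, hT⟩, ?_⟩
  rw [nhds_induced, ← map_le_iff_le_comap]
  refine tendsto_pi_nhds.2 fun n => ?_
  rw [hTf]
  exact hf (d n)

instance baireSpace_isometricSemigroups [TopologicalSpace.SeparableSpace H] :
    BaireSpace (isometricSemigroups H) := by
  have hd := TopologicalSpace.denseRange_denseSeq H
  rw [← orbitUniformSpace_toTopologicalSpace hd]
  let _ := orbitUniformSpace (TopologicalSpace.denseSeq H)
  have := completeSpace_orbitUniformSpace hd
  have : (𝓤 (isometricSemigroups H)).IsCountablyGenerated := comap.isCountablyGenerated _ _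
  infer_instance

theorem _root_.BaireSpace.of_dense {X : Type*} [TopologicalSpace X] {s : Set X} (hs : Dense s)
    [BaireSpace s] : BaireSpace X where
  baire_property f ho hd := by
    have h := dense_iInter_of_isOpen_nat (f := fun n => ((↑) : s → X) ⁻¹' f n)
      (fun n => (ho n).preimage continuous_subtype_val) fun n => Subtype.dense_iff.2 fun x hx => by
        rw [Subtype.image_preimage_coe]
        exact (hs.inter_of_isOpen_right (hd n) (ho n)) x
    rw [← Set.preimage_iInter] at h
    have h' := Subtype.dense_iff.1 h
    rw [Subtype.image_preimage_coe] at h'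
    exact (hs.mono fun x hx => h' hx).of_closure.mono Set.inter_subset_right

end

end ContractiveC0Semigroup


theorem mainTheorem3 (H : Type*) [NormedAddCommGroup H] [InnerProductSpace ℂ H] [CompleteSpace H]
    [TopologicalSpace.SeparableSpace H] (hH : ¬ FiniteDimensional ℂ H) :
    ContractiveC0Semigroup.unitarySemigroups H ∈ residual (ContractiveC0Semigroup H) ∧
      ¬ IsMeagre (ContractiveC0Semigroup.unitarySemigroups H) := by
  have hU := ContractiveC0Semigroup.dense_unitarySemigroups hH
  have hres := ContractiveC0Semigroup.unitarySemigroups_mem_residual hU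
  have : BaireSpace (ContractiveC0Semigroup H) :=
    .of_dense (s := ContractiveC0Semigroup.isometricSemigroups H) <|
      hU.mono ContractiveC0Semigroup.unitarySemigroups_subset_isometricSemigroups
  -- If the set were meagre, its complement would be residual too, making the empty set dense in a
  -- nonempty Baire space.
  exact ⟨hres, fun hm => by simpa using (dense_of_mem_residual (inter_mem hres hm)).nonempty⟩
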